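/- For a group $H$, the prime graph $\Pi(H)$ is the graph whose vertices are the primes $p$ for which $H$ has an element of order $p$, two different vertices $p$ and $q$ being joined by an edge if and only if $H$ has an element of order $pq$. For a finite group $H$, let $V(\mathbb{Z}H)$ denote the group of normalised units of the integral group ring $\mathbb{Z}H$, i.e. the group of all units of augmentation $1$. We say that the prime graph question has a positive answer for $H$ if $\Pi(V(\mathbb{Z}H)) = \Pi(H)$. A group $X$ is called almost simple if there is a finite non-abelian simple group $S$ such that $X$ is isomorphic to a subgroup of $\operatorname{Aut}(S)$ containing $\operatorname{Inn}(S)$. Theorem. Let $G$ be a finite group. Assume that the prime graph question has a positive answer for every almost simple group $X$ which is a homomorphic image of $G$. Then the prime graph question has a positive answer for $G$. -/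

import Mathlib

universe u

/-- The prime graph of a group `G`. Its vertices are the primes `p` such that `G` has an element of
order `p`; two different vertices `p`, `q` are joined by an edge iff `G` has an element of order
`p * q`. A graph with a vertex set of primes is a subgraph of the complete graph on all primes. -/
def primeGraph (G : Type*) [Group G] : (⊤ : SimpleGraph Nat.Primes).Subgraph where
  verts := {p | ∃ x : G, orderOf x = p}
  Adj p q := p ≠ q ∧ ∃ x : G, orderOf x = p * q
  adj_sub h := h.1
  edge_vert := by
    rintro p q ⟨-, x, hx⟩
    refine ⟨x ^ (q : ℕ), ?_⟩
    rw [orderOf_pow_of_dvd q.2.ne_zero (hx ▸ Dvd.intro_left _ rfl), hx,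
      Nat.mul_div_cancel _ q.2.pos]
  symm := ⟨fun _ _ ⟨hne, x, hx⟩ => ⟨hne.symm, x, by rw [hx, mul_comm]⟩⟩

/-- The augmentation of the integral group ring: the ring homomorphism `ℤG → ℤ` that maps every
`g ∈ G` to `1`, so that `∑ a_g g` is mapped to `∑ a_g`. -/
noncomputable def augmentation (G : Type*) [Group G] : MonoidAlgebra ℤ G →ₐ[ℤ] ℤ :=
  MonoidAlgebra.lift ℤ ℤ G 1

/-- The group `V(ℤG)` of normalised units: the units of `ℤG` of augmentation `1`. -/
noncomputable def normalizedUnits (G : Type*) [Group G] : Subgroup (MonoidAlgebra ℤ G)ˣ :=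
  (Units.map (augmentation G : MonoidAlgebra ℤ G →* ℤ)).ker

/-- The prime graph question has a positive answer for `G`: the prime graph of `V(ℤG)` (the
Gruenberg-Kegel graph of `ℤG`) coincides with the prime graph of `G`. -/
def PrimeGraphQuestion (G : Type*) [Group G] : Prop :=
  primeGraph (normalizedUnits G) = primeGraph G

/-- `X` is almost simple: for some finite non-abelian simple group `S`, it is (isomorphic to) a
subgroup of the automorphism group of `S` that contains all inner automorphisms of `S`. -/
def IsAlmostSimple (X : Type u) [Group X] : Prop :=
  ∃ (S : Type u) (_ : Group S), Finite S ∧ IsSimpleGroup S ∧ (∃ a b : S, a * b ≠ b * a) ∧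
    ∃ H : Subgroup (MulAut S), (MulAut.conj : S →* MulAut S).range ≤ H ∧ Nonempty (X ≃* H)

/-! Induct on the order of G. Let u be a normalised unit of order pq and suppose that G has no
element of order pq.

If N is a nontrivial normal subgroup with q not dividing |N|, then the image v of u modulo N still
has order pq. By induction G/N has an element of order pq, and so has G. Here v^p = 1 is excluded by
`prime_dvd_card_of_map_mk_eq_one`. In `not_map_mk_pow_eq_one`, v^q = 1 is excluded by computing the
coefficient sum of u over the nontrivial p-elements twice: the q-th power congruence gives 1 mod q,
and projection to G/N gives 0.

By symmetry both primes divide the order of every nontrivial normal subgroup. Two elementwise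
commuting subgroups, one of order divisible by p and the other by q, would yield an element of order
pq. This forces a minimal normal subgroup to be non-abelian simple with trivial centralizer, so G is
almost simple and the hypothesis applies to G itself.

The coefficient sums are controlled by the Berman-Higman theorem `coeff_one_eq_zero`, and by
`sum_coeff_eq_zero` and `sum_coeff_pow_prime_modEq`, which count words up to cyclic rotation. -/

open Finset

/-! ### Orbit counting and cyclic rotation of words -/

/-- The sum of an invariant weight over the points whose period under a permutation of order
dividing `p ^ n` is at least `p ^ k` is divisible by `p ^ k`. -/
theorem pow_dvd_sum_of_perm_invariant {X : Type*} [Fintype X] {p n k : ℕ} (hp : p.Prime)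
    (σ : Equiv.Perm X) (hσ : σ ^ p ^ n = 1) (w : X → ℤ) (hw : ∀ x, w (σ x) = w x)
    (hk : ∀ x, w x ≠ 0 → ∀ j < k, (σ ^ p ^ j) x ≠ x) : (p : ℤ) ^ k ∣ ∑ x, w x := by
  classical
  let Q := Quotient (MulAction.orbitRel (Subgroup.zpowers σ) X)
  rw [← Finset.sum_fiberwise (Finset.univ : Finset X) (fun x => (Quotient.mk _ x : Q)) w]
  refine Finset.dvd_sum fun c _ => ?_
  induction c using Quotient.inductionOn with | _ x => ?_
  have hw' : ∀ τ ∈ Subgroup.zpowers σ, ∀ y, w (τ y) = w y := by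
    intro τ hτ
    rw [Subgroup.zpowers_eq_closure] at hτ
    induction hτ using Subgroup.closure_induction with
    | mem a ha => rw [Set.mem_singleton_iff.1 ha]; exact hw
    | one => simp
    | mul a b _ _ iha ihb => intro y; rw [Equiv.Perm.mul_apply, iha, ihb]
    | inv a _ ih =>
      intro y
      rw [← ih (a⁻¹ y), ← Equiv.Perm.mul_apply, mul_inv_cancel, Equiv.Perm.one_apply]
  have hmem : ∀ y, (Quotient.mk _ y : Q) = Quotient.mk _ x ↔
      y ∈ MulAction.orbit (Subgroup.zpowers σ) x := fun y => Quotient.eq.trans Iff.rfl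
  have hconst : ∀ y ∈ Finset.univ.filter (fun y => (Quotient.mk _ y : Q) = Quotient.mk _ x),
      w y = w x := by
    intro y hy
    rw [Finset.mem_filter, hmem] at hy
    obtain ⟨-, ⟨τ, hτ⟩, rfl⟩ := hy
    exact hw' τ hτ x
  rw [Finset.sum_congr rfl hconst, Finset.sum_const, nsmul_eq_mul]
  by_cases hx : w x = 0
  · simp [hx]
  refine Dvd.dvd.mul_right ?_ _
  have hcard : (Finset.univ.filter (fun y => (Quotient.mk _ y : Q) = Quotient.mk _ x)).card
      = Function.minimalPeriod σ x := by
    have := MulAction.minimalPeriod_eq_card (a := σ) (b := x)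
    rw [← Fintype.card_subtype, ← Nat.card_eq_fintype_card]
    simp_rw [hmem]
    rw [← Nat.card_eq_fintype_card] at this
    exact this.symm
  rw [hcard]
  have hper : ∀ m, (σ ^ m) x = x ↔ Function.minimalPeriod σ x ∣ m := by
    intro m
    rw [← Function.isPeriodicPt_iff_minimalPeriod_dvd, Function.IsPeriodicPt,
      Function.IsFixedPt, Equiv.Perm.iterate_eq_pow]
  obtain ⟨j, hj, hj'⟩ := (Nat.dvd_prime_pow hp).1 ((hper (p ^ n)).1 (by simp [hσ]))
  rw [hj']
  have : k ≤ j := by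
    by_contra! h
    exact hk x hx j h ((hper _).2 hj'.dvd)
  exact_mod_cast pow_dvd_pow p this

namespace MonoidAlgebra

variable {G : Type*}

theorem pow_eq_sum_single_ofFn [Monoid G] [Fintype G] (u : MonoidAlgebra ℤ G) (m : ℕ) :
    u ^ m = ∑ f : Fin m → G, single (List.ofFn f).prod (∏ i, u.coeff (f i)) := by
  induction m with
  | zero => simp [one_def]
  | succ m ih =>
    have hu : u = ∑ g, single g (u.coeff g) := by
      ext g
      classical
      simp
    rw [pow_succ', ih, ← (Fin.consEquiv fun _ => G).sum_comp, Fintype.sum_prod_type]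
    conv_lhs => enter [1]; rw [hu]
    rw [Finset.sum_mul_sum]
    simp [Fin.consEquiv, Fin.prod_univ_succ, single_mul_single]

theorem sum_coeff_pow [Monoid G] [Fintype G] [DecidableEq G] (u : MonoidAlgebra ℤ G) (m : ℕ)
    (A : Finset G) : ∑ g ∈ A, (u ^ m).coeff g =
      ∑ f : Fin m → G, if (List.ofFn f).prod ∈ A then ∏ i, u.coeff (f i) else 0 := by
  rw [pow_eq_sum_single_ofFn]
  simp only [coeff_sum, Finsupp.finsetSum_apply, coeff_single, Finsupp.single_apply]
  rw [Finset.sum_comm]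
  simp

end MonoidAlgebra

/-- Cyclic rotation of words of length `m`. -/
def rotateWord (G : Type*) (m : ℕ) : Equiv.Perm (Fin m → G) :=
  (finRotate m).symm.arrowCongr (Equiv.refl G)

theorem rotateWord_apply {G : Type*} {m : ℕ} (f : Fin m → G) (i : Fin m) :
    rotateWord G m f i = f (finRotate m i) := rfl

theorem rotateWord_pow_apply {G : Type*} {m : ℕ} [NeZero m] (f : Fin m → G) (k : ℕ) (i : Fin m) :
    (rotateWord G m ^ k) f i = f (Fin.ofNat m (i + k)) := by
  obtain ⟨m, rfl⟩ : ∃ l, m = l + 1 := ⟨m - 1, by have := NeZero.ne m; omega⟩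
  induction k generalizing i with
  | zero => simp
  | succ k ih =>
    rw [pow_succ', Equiv.Perm.mul_apply, rotateWord_apply, ih, finRotate_apply]
    congr 1
    ext
    simp [Fin.val_add]
    congr 1; ring

theorem rotateWord_pow_self {G : Type*} (m : ℕ) [NeZero m] : rotateWord G m ^ m = 1 := by
  ext f i
  rw [rotateWord_pow_apply, Equiv.Perm.one_apply]
  congr 1
  ext
  simp [Nat.mod_eq_of_lt i.2]

/-- Moving the first letter to the end conjugates the product by that letter's inverse. -/
theorem prod_ofFn_rotateWord {G : Type*} [Group G] {m : ℕ} (f : Fin m → G) :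
    ∃ x : G, (List.ofFn (rotateWord G m f)).prod = x * (List.ofFn f).prod * x⁻¹ := by
  cases m with
  | zero => exact ⟨1, by simp⟩
  | succ m =>
    refine ⟨(f 0)⁻¹, ?_⟩
    rw [List.ofFn_succ', List.ofFn_succ]
    simp [rotateWord_apply]

/-- A word which is invariant under rotation by `d` is a power of its initial segment. -/
theorem exists_prod_ofFn_eq_pow {G : Type*} [Group G] {d e : ℕ} [NeZero (e * d)]
    (f : Fin (e * d) → G) (hf : (rotateWord G (e * d) ^ d) f = f) :
    ∃ x : G, (List.ofFn f).prod = x ^ e := by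
  have hd : 0 < d := Nat.pos_of_ne_zero fun h => NeZero.ne (e * d) (by simp [h])
  have he : 0 < e := Nat.pos_of_ne_zero fun h => NeZero.ne (e * d) (by simp [h])
  have key : ∀ (i : ℕ) (j : ℕ) (h : i * d + j < e * d),
      f ⟨i * d + j, h⟩ = f ⟨j, by omega⟩ := by
    intro i j
    induction i with
    | zero => intro h; simp
    | succ i ih =>
      intro h
      have h' : i * d + j < e * d := by rw [add_mul] at h; omega
      rw [← ih h', ← congrFun hf ⟨i * d + j, h'⟩, rotateWord_pow_apply]
      congr 1
      ext
      simp only [Fin.ofNat]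
      rw [Nat.mod_eq_of_lt] <;> rw [add_mul] at h <;> [ring; omega]
  have hlt : ∀ j : Fin d, (j : ℕ) < e * d := fun j => j.2.trans_le (Nat.le_mul_of_pos_left d he)
  refine ⟨(List.ofFn fun j : Fin d => f ⟨j, hlt j⟩).prod, ?_⟩
  rw [List.ofFn_mul, List.prod_flatten, List.map_ofFn]
  simp only [Function.comp_def, key]
  exact (congrArg List.prod (List.ofFn_const e
    (List.ofFn fun j : Fin d => f ⟨j, hlt j⟩).prod)).trans (List.prod_replicate _ _)

/-! ### Coefficient sums of powers and of torsion units -/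

namespace MonoidAlgebra

variable {G : Type*} [Group G]

theorem prod_coeff_rotateWord {G : Type*} (u : MonoidAlgebra ℤ G) {m : ℕ} (f : Fin m → G) :
    ∏ i, u.coeff (rotateWord G m f i) = ∏ i, u.coeff (f i) :=
  Equiv.prod_comp (finRotate m) fun i => u.coeff (f i)

theorem prod_ofFn_rotateWord_mem_iff {A : Finset G} (hA : ∀ x, ∀ g ∈ A, x * g * x⁻¹ ∈ A) {m : ℕ}
    (f : Fin m → G) : (List.ofFn (rotateWord G m f)).prod ∈ A ↔ (List.ofFn f).prod ∈ A := by
  obtain ⟨x, hx⟩ := prod_ofFn_rotateWord f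
  rw [hx]
  refine ⟨fun h => ?_, hA x _⟩
  simpa [mul_assoc] using hA x⁻¹ _ h

variable [Fintype G]

/-- Rotation acts on the contributing words of length p. Modulo p only the constant words survive,
and Fermat's little theorem removes the exponent. -/
theorem sum_coeff_pow_prime_modEq [DecidableEq G] (u : MonoidAlgebra ℤ G) {p : ℕ} (hp : p.Prime)
    {A : Finset G} (hA : ∀ x, ∀ g ∈ A, x * g * x⁻¹ ∈ A) :
    ∑ g ∈ A, (u ^ p).coeff g ≡ ∑ g with g ^ p ∈ A, u.coeff g [ZMOD p] := by
  have : NeZero p := ⟨hp.ne_zero⟩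
  have : Fact p.Prime := ⟨hp⟩
  rw [sum_coeff_pow]
  set w : (Fin p → G) → ℤ := fun f => if (List.ofFn f).prod ∈ A then ∏ i, u.coeff (f i) else 0
    with hw
  rw [← Finset.sum_filter_add_sum_filter_not _ (fun f => rotateWord G p f = f)]
  have h1 : (p : ℤ) ∣ ∑ f with ¬ rotateWord G p f = f, w f := by
    rw [Finset.sum_filter, ← pow_one (p : ℤ)]
    refine pow_dvd_sum_of_perm_invariant (n := 1) hp (rotateWord G p)
      (by rw [pow_one, rotateWord_pow_self]) _ ?_ ?_
    · intro f
      simp only [hw, prod_ofFn_rotateWord_mem_iff hA, prod_coeff_rotateWord,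
        EmbeddingLike.apply_eq_iff_eq]
    · intro f hf j hj
      obtain rfl : j = 0 := by omega
      simp only [ne_eq, ite_eq_right_iff, not_forall] at hf
      simpa using hf.1
  have hconst : ∀ f, rotateWord G p f = f → ∀ i, f i = f 0 := by
    intro f h i
    have : ∀ k : ℕ, (rotateWord G p ^ k) f = f := fun k => by
      induction k with
      | zero => rfl
      | succ k ih => rw [pow_succ, Equiv.Perm.mul_apply, h, ih]
    have h3 := congrFun (this i) 0
    rw [rotateWord_pow_apply] at h3
    simpa using h3
  have h2 : ∑ f with rotateWord G p f = f, w f = ∑ g with g ^ p ∈ A, u.coeff g ^ p := by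
    rw [Finset.sum_filter (fun g : G => g ^ p ∈ A)]
    refine Finset.sum_nbij' (fun f => f 0) (fun g _ => g) (by simp) ?_ ?_ (by simp) ?_
    · intro g _
      simp only [mem_filter, mem_univ, true_and]
      rfl
    · intro f hf
      funext i
      exact (hconst f (Finset.mem_filter.1 hf).2 i).symm
    · intro f hf
      have hf' : f = fun _ => f 0 := funext (hconst f (Finset.mem_filter.1 hf).2)
      rw [hf']
      simp [hw]
  rw [h2]
  have h3 : ∑ g with g ^ p ∈ A, u.coeff g ^ p ≡ ∑ g with g ^ p ∈ A, u.coeff g [ZMOD p] := by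
    rw [← ZMod.intCast_eq_intCast_iff]
    push_cast
    simp [ZMod.pow_card]
  simpa using h3.add ((Int.modEq_zero_iff_dvd).2 h1)

/-- Let p^s be the p-part of |G|. A word of length p^(k+s) fixed by rotation by p^j with j < k has
as product a p^(k+s-j)-th power. Since k+s-j > s, the order of the product is prime to p, so the
word does not contribute. All other orbits have length divisible by p^k. -/
theorem pow_dvd_sum_coeff_pow_prime_pow (u : MonoidAlgebra ℤ G) {p : ℕ}
    (hp : p.Prime) {A : Finset G} (hA : ∀ x, ∀ g ∈ A, x * g * x⁻¹ ∈ A)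
    (hpA : ∀ g ∈ A, p ∣ orderOf g) (k : ℕ) :
    (p : ℤ) ^ k ∣ ∑ g ∈ A, (u ^ p ^ (k + (Nat.card G).factorization p)).coeff g := by
  classical
  set s := (Nat.card G).factorization p
  have : NeZero (p ^ (k + s)) := ⟨pow_ne_zero _ hp.ne_zero⟩
  rw [sum_coeff_pow]
  refine pow_dvd_sum_of_perm_invariant (n := k + s) hp (rotateWord G _)
    (rotateWord_pow_self _) _ ?_ ?_
  · intro f
    simp only [prod_ofFn_rotateWord_mem_iff hA, prod_coeff_rotateWord]
  · intro f hf j hj hfix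
    simp only [ne_eq, ite_eq_right_iff, not_forall] at hf
    obtain ⟨hf, -⟩ := hf
    have hpow : ∃ x : G, (List.ofFn f).prod = x ^ p ^ (k + s - j) := by
      have hm : p ^ (k + s) = p ^ (k + s - j) * p ^ j := by rw [← pow_add]; congr 1; omega
      clear_value s
      clear hpA hA hf
      generalize p ^ (k + s) = m at *
      subst hm
      exact exists_prod_ofFn_eq_pow f hfix
    obtain ⟨x, hx⟩ := hpow
    have h1 := hpA _ hf
    rw [hx] at h1
    have h2 : p ^ (s + 1) ∣ p ^ (k + s - j) := pow_dvd_pow _ (by omega)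
    have h3 : orderOf x ∣ Nat.card G := orderOf_dvd_natCard x
    have hG : Nat.card G ≠ 0 := Nat.card_pos.ne'
    obtain ⟨c, hc⟩ := h1
    have h4 : orderOf (x ^ p ^ (k + s - j)) * p ^ (k + s - j) ∣ orderOf x * p ^ (k + s - j) :=
      mul_dvd_mul_right (orderOf_pow_dvd _) _
    have h5 : orderOf (x ^ p ^ (k + s - j)) = orderOf x / (orderOf x).gcd (p ^ (k + s - j)) :=
      orderOf_pow x
    obtain ⟨i, hi, hi'⟩ := (Nat.dvd_prime_pow hp).1
      (Nat.gcd_dvd_right (orderOf x) (p ^ (k + s - j)))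
    have h6 : orderOf x = p * c * p ^ i := by
      rw [← hc, h5, ← hi', Nat.div_mul_cancel (Nat.gcd_dvd_left _ _)]
    have h7 : p ^ (i + 1) ∣ orderOf x := ⟨c, by rw [h6]; ring⟩
    have h8 : i + 1 ≤ s := (hp.pow_dvd_iff_le_factorization hG).1 (h7.trans h3)
    have h9 : p ^ (i + 1) ∣ p ^ i := by
      rw [← hi']
      exact Nat.dvd_gcd h7 (pow_dvd_pow _ (by omega))
    have := (Nat.pow_dvd_pow_iff_le_right hp.one_lt).1 h9
    omega

/-- Powers of p congruent to 1 mod m fix u, so the preceding divisibility holds for u itself with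
arbitrarily large exponents. -/
theorem sum_coeff_eq_zero_of_prime_not_dvd {u : MonoidAlgebra ℤ G} {m : ℕ} (hm : u ^ m = 1)
    {p : ℕ} (hp : p.Prime) (hpm : ¬ p ∣ m) {A : Finset G} (hA : ∀ x, ∀ g ∈ A, x * g * x⁻¹ ∈ A)
    (hpA : ∀ g ∈ A, p ∣ orderOf g) : ∑ g ∈ A, u.coeff g = 0 := by
  set s := (Nat.card G).factorization p with hs
  have hm0 : m ≠ 0 := by rintro rfl; simp at hpm
  have hφ : 0 < m.totient := Nat.totient_pos.2 (Nat.pos_of_ne_zero hm0)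
  have hcop : p.Coprime m := (Nat.Prime.coprime_iff_not_dvd hp).2 hpm
  by_contra hne
  set S := ∑ g ∈ A, u.coeff g with hS
  have key : ∀ k, (p : ℤ) ^ k ∣ S := by
    intro k
    -- Subtracting s makes the total exponent of p a multiple of φ(m).
    have h1 := pow_dvd_sum_coeff_pow_prime_pow u hp hA hpA (m.totient * (k + s) - s)
    have hle : k + s ≤ m.totient * (k + s) := Nat.le_mul_of_pos_left _ hφ
    rw [← hs, Nat.sub_add_cancel (by omega)] at h1
    have h2 : u ^ p ^ (m.totient * (k + s)) = u := by
      have h3 : p ^ (m.totient * (k + s)) ≡ 1 [MOD m] := by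
        rw [pow_mul]
        simpa using (Nat.ModEq.pow_totient hcop).pow (k + s)
      have h4 : 1 ≤ p ^ (m.totient * (k + s)) := Nat.one_le_pow _ _ hp.pos
      obtain ⟨c, hc⟩ := (Nat.modEq_iff_dvd' h4).1 h3.symm
      rw [show p ^ (m.totient * (k + s)) = m * c + 1 by omega, pow_succ, pow_mul, hm, one_pow,
        one_mul]
    rw [h2] at h1
    exact (pow_dvd_pow _ (by omega)).trans h1
  -- Taking k = |S| contradicts |S| < p^|S|.
  have h1 := Int.natAbs_dvd_natAbs.2 (key S.natAbs)
  rw [Int.natAbs_pow, Int.natAbs_natCast] at h1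
  have h2 := Nat.le_of_dvd (Int.natAbs_pos.2 hne) h1
  exact absurd h2 (not_le.2 (Nat.lt_pow_self hp.one_lt))

/-- The coefficients of a torsion unit sum to zero over any normal set of elements whose orders have
a prime divisor not dividing the order of the unit. -/
theorem sum_coeff_eq_zero {u : MonoidAlgebra ℤ G} {m : ℕ} (hm : u ^ m = 1)
    {A : Finset G} (hA : ∀ x, ∀ g ∈ A, x * g * x⁻¹ ∈ A)
    (hpA : ∀ g ∈ A, ∃ p, p.Prime ∧ ¬ p ∣ m ∧ p ∣ orderOf g) : ∑ g ∈ A, u.coeff g = 0 := by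
  classical
  -- The prime may vary over A, but one prime serves a whole conjugacy class.
  rw [← Finset.sum_fiberwise A ConjClasses.mk]
  refine Finset.sum_eq_zero fun c _ => ?_
  rcases (A.filter (ConjClasses.mk · = c)).eq_empty_or_nonempty with h | ⟨a, ha⟩
  · rw [h, Finset.sum_empty]
  rw [Finset.mem_filter] at ha
  obtain ⟨p, hp, hpm, hpa⟩ := hpA a ha.1
  refine sum_coeff_eq_zero_of_prime_not_dvd hm hp hpm ?_ ?_
  · intro x g hg
    rw [Finset.mem_filter] at hg ⊢
    refine ⟨hA x g hg.1, ?_⟩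
    rw [← hg.2, ConjClasses.mk_eq_mk_iff_isConj]
    exact (isConj_iff.2 ⟨x, rfl⟩).symm
  · intro g hg
    rw [Finset.mem_filter, ← ha.2, ConjClasses.mk_eq_mk_iff_isConj] at hg
    obtain ⟨x, hx⟩ := isConj_iff.1 hg.2
    rw [← hx] at hpa
    have : orderOf (x * g * x⁻¹) = orderOf g := by
      rw [← MulAut.conj_apply, MulEquiv.orderOf_eq]
    rwa [this] at hpa

end MonoidAlgebra

/-! ### The Berman-Higman theorem -/

/-- A complex matrix of finite order whose trace has real part at least its size is the identity. -/
theorem Matrix.eq_one_of_pow_eq_one_of_card_le_trace {n : Type*} [Fintype n] [DecidableEq n]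
    {M : Matrix n n ℂ} {k : ℕ} (hk : 0 < k) (hM : M ^ k = 1)
    (ht : (Fintype.card n : ℝ) ≤ M.trace.re) : M = 1 := by
  open Polynomial in
  have hroot : ∀ r ∈ M.charpoly.roots, ‖r‖ = 1 := by
    intro r hr
    have h1 : r ∈ spectrum ℂ M :=
      Matrix.mem_spectrum_iff_isRoot_charpoly.2 (isRoot_of_mem_roots hr)
    have h2 := spectrum.pow_mem_pow M k h1
    rw [hM] at h2
    have : Nontrivial (Matrix n n ℂ) := by
      by_contra h
      rw [not_nontrivial_iff_subsingleton] at h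
      simp [spectrum.of_subsingleton] at h1
    rw [spectrum.one_eq, Set.mem_singleton_iff] at h2
    exact Complex.norm_eq_one_of_pow_eq_one h2 hk.ne'
  have hcard : M.charpoly.roots.card = Fintype.card n := by
    rw [← (IsAlgClosed.splits M.charpoly).natDegree_eq_card_roots, Matrix.charpoly_natDegree_eq_dim]
  -- Eigenvalues of modulus 1 whose real parts sum to at least their number all equal 1.
  have hone : ∀ r ∈ M.charpoly.roots, r = 1 := by
    rw [Matrix.trace_eq_sum_roots_charpoly, ← hcard] at ht
    generalize M.charpoly.roots = R at hroot ht
    have hre : ∀ r ∈ R, r.re ≤ 1 := fun r hr => (Complex.re_le_norm r).trans (hroot r hr).le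
    have hsum : ∀ S : Multiset ℂ, (∀ r ∈ S, r.re ≤ 1) → S.sum.re ≤ S.card := by
      intro S
      induction S using Multiset.induction with
      | empty => simp
      | cons a S ih =>
        intro h
        have h1 := h a (Multiset.mem_cons_self a S)
        have h2 := ih fun r hr => h r (Multiset.mem_cons_of_mem hr)
        simp only [Multiset.sum_cons, Complex.add_re, Multiset.card_cons, Nat.cast_add,
          Nat.cast_one]
        linarith
    intro r hr
    obtain ⟨S, rfl⟩ := Multiset.exists_cons_of_mem hr
    have h2 := hsum S fun r hr => hre r (Multiset.mem_cons_of_mem hr)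
    simp only [Multiset.sum_cons, Complex.add_re, Multiset.card_cons, Nat.cast_add,
      Nat.cast_one] at ht
    have h3 : r.re = 1 := le_antisymm (hre r hr) (by linarith)
    have h4 := Complex.sq_norm r
    rw [hroot r hr, Complex.normSq_apply, h3] at h4
    have h5 : r.im = 0 := by nlinarith
    exact Complex.ext h3 h5
  have hchar : M.charpoly = (X - C 1) ^ Fintype.card n := by
    have := (IsAlgClosed.splits M.charpoly).eq_prod_roots_of_monic M.charpoly_monic
    rw [this, Multiset.eq_replicate.2 ⟨hcard, hone⟩]
    simp
  -- Separability of X^k - 1 makes M diagonalizable: its minimal polynomial is squarefree, so it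
  -- divides X - 1.
  have hsep : (X ^ k - 1 : ℂ[X]).Separable := by
    have := separable_X_pow_sub_C (F := ℂ) (n := k) 1 (by exact_mod_cast hk.ne') one_ne_zero
    simpa using this
  have h1 : minpoly ℂ M ∣ X ^ k - 1 := minpoly.dvd _ _ (by simp [hM])
  have h2 : minpoly ℂ M ∣ (X - C 1) ^ Fintype.card n := hchar ▸ Matrix.minpoly_dvd_charpoly M
  have h3 : minpoly ℂ M ∣ X - C 1 := (hsep.of_dvd h1).squarefree.isRadical _ _ h2
  obtain ⟨q, hq⟩ := h3
  have h4 : aeval M (X - C 1 : ℂ[X]) = 0 := by rw [hq, map_mul, minpoly.aeval, zero_mul]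
  simpa [sub_eq_zero] using h4

namespace MonoidAlgebra

variable {G : Type*} [Group G]

theorem coeff_mul_single_self {R : Type*} [Semiring R] (u : MonoidAlgebra R G) (g : G) :
    (u * single g 1).coeff g = u.coeff 1 := by
  rw [coeff_mul_single_eq_coeff_mul 1 (by simp), mul_one]

/-- In the regular representation the trace of u is |G| times its coefficient at 1, hence at least
the dimension. -/
theorem eq_one_of_pow_eq_one_of_one_le_coeff_one [Fintype G] {u : MonoidAlgebra ℤ G} {k : ℕ}
    (hk : 0 < k) (hu : u ^ k = 1) (h1 : 1 ≤ u.coeff 1) : u = 1 := by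
  classical
  let b : Module.Basis G ℤ (MonoidAlgebra ℤ G) := MonoidAlgebra.basis G ℤ
  let φ : MonoidAlgebra ℤ G →+* Matrix G G ℂ :=
    (Int.castRingHom ℂ).mapMatrix.comp (Algebra.leftMulMatrix b : _ →+* _)
  have hφ : Function.Injective φ := by
    intro x y hxy
    apply Algebra.leftMulMatrix_injective b
    ext i j
    have := congrFun (congrFun hxy i) j
    exact Int.cast_injective (α := ℂ) this
  have htr : (φ u).trace = Fintype.card G * u.coeff 1 := by
    have : ∀ g, φ u g g = u.coeff 1 := by
      intro g
      change ((Algebra.leftMulMatrix b u g g : ℤ) : ℂ) = _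
      rw [Algebra.leftMulMatrix_eq_repr_mul]
      have : (b.repr (u * b g)) g = (u * single g 1).coeff g := rfl
      rw [this, coeff_mul_single_self]
    simp [Matrix.trace, this]
  apply hφ
  rw [map_one]
  refine Matrix.eq_one_of_pow_eq_one_of_card_le_trace hk (by rw [← map_pow, hu, map_one]) ?_
  rw [htr]
  have : (1 : ℝ) ≤ u.coeff 1 := by exact_mod_cast h1
  simpa using le_mul_of_one_le_right (Nat.cast_nonneg (Fintype.card G)) this

/-- The Berman-Higman theorem: a normalised torsion unit other than `1` has no `1`-coefficient. -/
theorem coeff_one_eq_zero [Fintype G] {u : MonoidAlgebra ℤ G} {k : ℕ} (hk : 0 < k)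
    (hu : u ^ k = 1) (haug : augmentation G u = 1) (hne : u ≠ 1) : u.coeff 1 = 0 := by
  by_contra h
  rcases lt_or_gt_of_ne h with h | h
  -- A negative coefficient makes -u satisfy the previous lemma, but -u has augmentation -1.
  · have h1 : -u = 1 := by
      refine eq_one_of_pow_eq_one_of_one_le_coeff_one (k := 2 * k) (by omega) ?_ ?_
      · rw [pow_mul, neg_sq, ← pow_mul, mul_comm, pow_mul, hu, one_pow]
      · simp; omega
    have h2 := congrArg (augmentation G) h1
    rw [map_neg, haug, map_one] at h2
    omega
  · exact hne (eq_one_of_pow_eq_one_of_one_le_coeff_one hk hu h)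

theorem augmentation_eq_sum_coeff [Fintype G] (u : MonoidAlgebra ℤ G) :
    augmentation G u = ∑ g, u.coeff g := by
  rw [augmentation, lift_apply, Finsupp.sum_fintype] <;> simp

theorem sum_coeff_mapDomainRingHom [Fintype G] {H : Type*} [Group H] [DecidableEq H] (f : G →* H)
    (u : MonoidAlgebra ℤ G) (B : Finset H) :
    ∑ x ∈ B, (mapDomainRingHom ℤ f u).coeff x = ∑ g with f g ∈ B, u.coeff g := by
  have hu : u = ∑ g, single g (u.coeff g) := by
    ext g
    classical
    simp
  conv_lhs => rw [hu]
  simp [Finsupp.single_apply, Finset.sum_filter]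
  rw [Finset.sum_comm]
  simp

end MonoidAlgebra

/-! ### Element orders, and torsion units modulo a normal subgroup -/

theorem exists_orderOf_eq_of_dvd {G : Type*} [Group G] [Finite G] {g : G} {n : ℕ}
    (h : n ∣ orderOf g) : ∃ x : G, orderOf x = n := by
  obtain ⟨c, hc⟩ := h
  have hpos := orderOf_pos g
  have hc0 : 0 < c := Nat.pos_of_ne_zero fun h => by simp [hc, h] at hpos
  refine ⟨g ^ c, ?_⟩
  rw [orderOf_pow_of_dvd hc0.ne' ⟨n, by rw [hc, mul_comm]⟩, hc, Nat.mul_div_cancel _ hc0]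

theorem orderOf_conj {G : Type*} [Group G] (x g : G) : orderOf (x * g * x⁻¹) = orderOf g := by
  rw [← MulAut.conj_apply, MulEquiv.orderOf_eq]

theorem orderOf_eq_prime_mul_prime {M : Type*} [Monoid M] {p q : ℕ} (hp : p.Prime) (hq : q.Prime)
    {x : M} (h : x ^ (p * q) = 1) (h₁ : x ^ p ≠ 1) (h₂ : x ^ q ≠ 1) : orderOf x = p * q := by
  refine orderOf_eq_of_pow_and_pow_div_prime (Nat.mul_pos hp.pos hq.pos) h fun r hr hrpq => ?_
  rcases (hr.dvd_mul).1 hrpq with hd | hd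
  · rw [(Nat.prime_dvd_prime_iff_eq hr hp).1 hd, Nat.mul_div_cancel_left _ hp.pos]
    exact h₂
  · rw [(Nat.prime_dvd_prime_iff_eq hr hq).1 hd, Nat.mul_div_cancel _ hq.pos]
    exact h₁

namespace MonoidAlgebra

variable {G : Type*} [Group G] [Fintype G] {u : MonoidAlgebra ℤ G}

/-- The coefficient sums of a normalised torsion unit `u ≠ 1` over two normal sets agree if the
elements in the difference are trivial or have order with a prime divisor not dividing that of `u`. -/
theorem sum_coeff_eq_of_subset {m : ℕ} (hm : 0 < m) (hu : u ^ m = 1) (haug : augmentation G u = 1)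
    (hne : u ≠ 1) {A B : Finset G} (hBA : B ⊆ A) (hA : ∀ x, ∀ g ∈ A, x * g * x⁻¹ ∈ A)
    (hB : ∀ x, ∀ g ∈ B, x * g * x⁻¹ ∈ B)
    (h : ∀ g ∈ A, g ∉ B → g = 1 ∨ ∃ p, p.Prime ∧ ¬ p ∣ m ∧ p ∣ orderOf g) :
    ∑ g ∈ A, u.coeff g = ∑ g ∈ B, u.coeff g := by
  classical
  rw [← Finset.sum_sdiff hBA, add_eq_right, ← Finset.sum_filter_add_sum_filter_not _ (· = 1)]
  have h1 : ∑ g ∈ A \ B with g = 1, u.coeff g = 0 := by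
    refine Finset.sum_eq_zero fun g hg => ?_
    rw [(Finset.mem_filter.1 hg).2, coeff_one_eq_zero hm hu haug hne]
  rw [h1, zero_add]
  refine sum_coeff_eq_zero hu ?_ ?_
  · intro x g hg
    simp only [mem_filter, mem_sdiff] at hg ⊢
    refine ⟨⟨hA x g hg.1.1, fun hx => hg.1.2 ?_⟩, ?_⟩
    · simpa [mul_assoc] using hB x⁻¹ _ hx
    · rw [conj_eq_one_iff]; exact hg.2
  · intro g hg
    simp only [mem_filter, mem_sdiff] at hg
    exact (h g hg.1.1 hg.1.2).resolve_left hg.2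

/-- If p does not divide |G|, only 1 has p-th power 1, and the power congruence over {1} reads 1 ≡ 0
mod p. -/
theorem prime_dvd_card_of_pow_eq_one {p : ℕ} (hp : p.Prime) (hu : u ^ p = 1)
    (haug : augmentation G u = 1) (hne : u ≠ 1) : p ∣ Nat.card G := by
  classical
  by_contra hpG
  have h1 := sum_coeff_pow_prime_modEq u hp (A := {1}) (by simp)
  have h2 : (Finset.univ.filter fun g : G => g ^ p ∈ ({1} : Finset G)) = {1} := by
    ext g
    simp only [mem_singleton, mem_filter, mem_univ, true_and]
    refine ⟨fun h => ?_, fun h => by simp [h]⟩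
    rcases (Nat.dvd_prime hp).1 (orderOf_dvd_of_pow_eq_one h) with h | h
    · exact orderOf_eq_one_iff.1 h
    · exact absurd (h ▸ orderOf_dvd_natCard g) hpG
  rw [h2, hu, Finset.sum_singleton, Finset.sum_singleton,
    coeff_one_eq_zero hp.pos hu haug hne, one_def, coeff_single, Finsupp.single_eq_same,
    Int.modEq_zero_iff_dvd] at h1
  exact hp.one_lt.ne' (by exact_mod_cast Int.eq_one_of_dvd_one (by positivity) h1)

theorem augmentation_mapDomainRingHom {G H : Type*} [Group G] [Group H] (f : G →* H)
    (u : MonoidAlgebra ℤ G) :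
    augmentation H (mapDomainRingHom ℤ f u) = augmentation G u := by
  have : ((augmentation H : MonoidAlgebra ℤ H →+* ℤ).comp (mapDomainRingHom ℤ f)) =
      (augmentation G : MonoidAlgebra ℤ G →+* ℤ) := by
    ext <;> simp [augmentation]
  exact DFunLike.congr_fun this u

/-- A normalised unit of prime order `p` which becomes trivial modulo `N` forces `p` to divide the
order of `N`. -/
theorem prime_dvd_card_of_map_mk_eq_one {p : ℕ} (hp : p.Prime) (hu : u ^ p = 1)
    (haug : augmentation G u = 1) (hne : u ≠ 1) (N : Subgroup G) [N.Normal]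
    (hN : mapDomainRingHom ℤ (QuotientGroup.mk' N) u = 1) : p ∣ Nat.card N := by
  classical
  by_contra hpN
  -- The coefficients of u over N sum to 1, yet would sum to 0 if p did not divide |N|.
  have h1 := sum_coeff_mapDomainRingHom (QuotientGroup.mk' N) u {1}
  rw [hN, Finset.sum_singleton, one_def, coeff_single, Finsupp.single_eq_same] at h1
  rw [sum_coeff_eq_of_subset hp.pos hu haug hne (Finset.empty_subset _) ?_ (by simp) ?_] at h1
  · simp at h1
  · intro x g hg
    simp only [mem_filter, mem_univ, true_and, mem_singleton, map_mul, map_inv] at hg ⊢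
    rw [hg, mul_one, mul_inv_cancel]
  · intro g hg _
    simp only [mem_filter, mem_univ, true_and, mem_singleton, QuotientGroup.mk'_apply,
      QuotientGroup.eq_one_iff] at hg
    by_cases hg1 : g = 1
    · exact Or.inl hg1
    obtain ⟨r, hr, hrg⟩ := Nat.exists_prime_and_dvd (fun h => hg1 (orderOf_eq_one_iff.1 h))
    refine Or.inr ⟨r, hr, fun h => hpN ?_, hrg⟩
    rw [← (Nat.prime_dvd_prime_iff_eq hr hp).1 h]
    exact hrg.trans (N.orderOf_dvd_natCard hg)

/-- Let `G` have no element of order `p * q` and let `N` be a normal subgroup of order prime to `q`.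
Then the image modulo `N` of a normalised unit of order `p * q` does not have order `q`. -/
theorem not_map_mk_pow_eq_one {p q : ℕ} (hp : p.Prime) (hq : q.Prime) (hpq : p ≠ q)
    (hG : ∀ g : G, orderOf g ≠ p * q) (hu : u ^ (p * q) = 1) (haug : augmentation G u = 1)
    (huq : u ^ q ≠ 1) (N : Subgroup G) [N.Normal] (hN : ¬ q ∣ Nat.card N)
    (hmap : mapDomainRingHom ℤ (QuotientGroup.mk' N) u ≠ 1) :
    mapDomainRingHom ℤ (QuotientGroup.mk' N) u ^ q ≠ 1 := by
  classical
  intro hmapq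
  have hG' : ∀ g : G, p ∣ orderOf g → ¬ q ∣ orderOf g := fun g h1 h2 => by
    obtain ⟨x, hx⟩ := exists_orderOf_eq_of_dvd
      (((Nat.coprime_primes hp hq).2 hpq).mul_dvd_of_dvd_of_dvd h1 h2)
    exact hG x hx
  have hu1 : u ≠ 1 := fun h => huq (by rw [h, one_pow])
  set A : Finset G := {g | g ≠ 1 ∧ ∀ r : ℕ, r.Prime → r ∣ orderOf g → r = p} with hAdef
  have hmemA : ∀ g, g ∈ A ↔ g ≠ 1 ∧ ∀ r : ℕ, r.Prime → r ∣ orderOf g → r = p := by simp [hAdef]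
  have hA : ∀ x, ∀ g ∈ A, x * g * x⁻¹ ∈ A := by
    intro x g hg
    rw [hmemA] at hg ⊢
    rwa [orderOf_conj, Ne, conj_eq_one_iff]
  have hsumq : ∑ g ∈ A, (u ^ q).coeff g = 1 := by
    have haugq : augmentation G (u ^ q) = 1 := by rw [map_pow, haug, one_pow]
    rw [← sum_coeff_eq_of_subset hp.pos (by rwa [← pow_mul, mul_comm]) haugq huq
      (Finset.subset_univ A) (by simp) hA, ← augmentation_eq_sum_coeff, haugq]
    intro g _ hg
    rw [hmemA] at hg
    push Not at hg
    by_cases hg1 : g = 1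
    · exact Or.inl hg1
    obtain ⟨r, hr, hrg, hrp⟩ := hg hg1
    exact Or.inr ⟨r, hr, fun h => hrp ((Nat.prime_dvd_prime_iff_eq hr hp).1 h), hrg⟩
  -- If g^q is a nontrivial p-element, then p divides the order of g; as no element has order pq, q
  -- does not.
  have hpow : (Finset.univ.filter fun g : G => g ^ q ∈ A) = A := by
    ext g
    simp only [mem_filter, mem_univ, true_and]
    rw [hmemA, hmemA]
    constructor
    · rintro ⟨h1, h2⟩
      refine ⟨fun h => h1 (by rw [h, one_pow]), fun r hr hrg => ?_⟩
      have h3 : orderOf g ∣ q * orderOf (g ^ q) :=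
        orderOf_dvd_of_pow_eq_one (by rw [pow_mul, pow_orderOf_eq_one])
      rcases (hr.dvd_mul).1 (hrg.trans h3) with h | h
      · obtain ⟨s, hs, hsg⟩ := Nat.exists_prime_and_dvd (fun h => h1 (orderOf_eq_one_iff.1 h))
        rw [(Nat.prime_dvd_prime_iff_eq hr hq).1 h] at hrg
        rw [h2 s hs hsg] at hsg
        exact absurd hrg (hG' g (hsg.trans (orderOf_pow_dvd q)))
      · exact h2 r hr h
    · rintro ⟨h1, h2⟩
      refine ⟨fun h => ?_, fun r hr hrg => h2 r hr (hrg.trans (orderOf_pow_dvd q))⟩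
      rcases (Nat.dvd_prime hq).1 (orderOf_dvd_of_pow_eq_one h) with h | h
      · exact h1 (orderOf_eq_one_iff.1 h)
      · exact hpq (h2 q hq h.symm.dvd).symm
  have hmod := sum_coeff_pow_prime_modEq u hq hA
  rw [hpow, hsumq] at hmod
  -- the same sum computed modulo `N`
  have : Fintype (G ⧸ N) := Fintype.ofFinite _
  set B : Finset (G ⧸ N) := {x | ∀ r : ℕ, r.Prime → r ∣ orderOf x → r = p} with hBdef
  have hmemB : ∀ x, x ∈ B ↔ ∀ r : ℕ, r.Prime → r ∣ orderOf x → r = p := by simp [hBdef]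
  have hB : ∀ y, ∀ x ∈ B, y * x * y⁻¹ ∈ B := by
    intro y x hx
    rw [hmemB] at hx ⊢
    rwa [orderOf_conj]
  -- The image has order q, so nontrivial p-elements contribute 0, and the identity does too by
  -- Berman-Higman.
  have hBzero : ∑ x ∈ B, (mapDomainRingHom ℤ (QuotientGroup.mk' N) u).coeff x = 0 := by
    rw [sum_coeff_eq_of_subset hq.pos hmapq (by rw [augmentation_mapDomainRingHom, haug]) hmap
      (Finset.empty_subset _) hB (by simp), Finset.sum_empty]
    intro x hx _
    by_cases hx1 : x = 1
    · exact Or.inl hx1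
    obtain ⟨r, hr, hrx⟩ := Nat.exists_prime_and_dvd (fun h => hx1 (orderOf_eq_one_iff.1 h))
    refine Or.inr ⟨r, hr, fun h => hpq ?_, hrx⟩
    rw [← (hmemB x).1 hx r hr hrx, (Nat.prime_dvd_prime_iff_eq hr hq).1 h]
  have hle : ∀ g : G, orderOf (QuotientGroup.mk' N g) ∣ orderOf g := orderOf_map_dvd _
  rw [sum_coeff_mapDomainRingHom, sum_coeff_eq_of_subset (B := A) (Nat.mul_pos hp.pos hq.pos) hu
    haug hu1 ?_ ?_ hA ?_] at hBzero
  · rw [hBzero] at hmod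
    have h1 := Int.modEq_zero_iff_dvd.1 hmod
    exact hq.one_lt.ne' (by exact_mod_cast Int.eq_one_of_dvd_one (by positivity) h1)
  · intro g hg
    rw [hmemA] at hg
    simp only [mem_filter, mem_univ, true_and]
    rw [hmemB]
    exact fun r hr hrg => hg.2 r hr (hrg.trans (hle g))
  · intro x g hg
    simp only [mem_filter, mem_univ, true_and, map_mul, map_inv] at hg ⊢
    exact hB _ _ hg
  · intro g hg hgA
    simp only [mem_filter, mem_univ, true_and] at hg
    rw [hmemB] at hg
    by_cases hg1 : g = 1
    · exact Or.inl hg1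
    refine Or.inr ?_
    -- Otherwise the order of g involves only p and q. As g is not in A, q occurs, which excludes p;
    -- so the p-element gN is trivial and q divides |N|.
    by_contra! hcon
    have hcon' : ∀ r : ℕ, r.Prime → r ∣ orderOf g → r = p ∨ r = q := fun r hr hrg => by
      have h1 : r ∣ p * q := by
        by_contra h
        exact hcon r hr h hrg
      rcases (hr.dvd_mul).1 h1 with h | h
      · exact Or.inl ((Nat.prime_dvd_prime_iff_eq hr hp).1 h)
      · exact Or.inr ((Nat.prime_dvd_prime_iff_eq hr hq).1 h)
    have hqg : q ∣ orderOf g := by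
      by_contra h
      refine hgA ((hmemA g).2 ⟨hg1, fun r hr hrg => (hcon' r hr hrg).resolve_right ?_⟩)
      rintro rfl
      exact h hrg
    have hgN : QuotientGroup.mk' N g = 1 := by
      by_contra h
      obtain ⟨r, hr, hrg⟩ := Nat.exists_prime_and_dvd (fun h' => h (orderOf_eq_one_iff.1 h'))
      have h1 := hg r hr hrg
      subst h1
      exact hG' g (hrg.trans (hle g)) hqg
    rw [QuotientGroup.mk'_apply, QuotientGroup.eq_one_iff] at hgN
    exact hN (hqg.trans (N.orderOf_dvd_natCard hgN))

end MonoidAlgebra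

/-! ### Prime graphs and normalised units -/

open MonoidAlgebra

/-- The group elements as normalised units of the integral group ring. -/
noncomputable def groupToNormalizedUnits (G : Type*) [Group G] : G →* normalizedUnits G :=
  ((Units.map (MonoidAlgebra.of ℤ G)).comp (toUnits (G := G)).toMonoidHom).codRestrict _
    fun g => by
      rw [normalizedUnits, MonoidHom.mem_ker]
      ext
      simp [augmentation]

theorem groupToNormalizedUnits_injective (G : Type*) [Group G] :
    Function.Injective (groupToNormalizedUnits G) := fun _ _ h =>
  MonoidAlgebra.of_injective (R := ℤ) (congrArg (fun x : normalizedUnits G => x.1.1) h)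

theorem augmentation_coe_normalizedUnits {G : Type*} [Group G] (x : normalizedUnits G) :
    augmentation G (x : (MonoidAlgebra ℤ G)ˣ) = 1 :=
  congrArg Units.val (MonoidHom.mem_ker.1 x.2)

theorem orderOf_coe_coe_normalizedUnits {G : Type*} [Group G] (x : normalizedUnits G) :
    orderOf ((x : (MonoidAlgebra ℤ G)ˣ) : MonoidAlgebra ℤ G) = orderOf x := by
  rw [orderOf_units, Subgroup.orderOf_coe]

/-- G embeds in its normalised units, and the vertex sets agree by `prime_dvd_card_of_pow_eq_one`
and Cauchy's theorem; only edges remain. -/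
theorem primeGraphQuestion_of_forall {G : Type*} [Group G] [Finite G]
    (h : ∀ p q : ℕ, p.Prime → q.Prime → p ≠ q → ∀ u : MonoidAlgebra ℤ G, augmentation G u = 1 →
      orderOf u = p * q → ∃ g : G, orderOf g = p * q) : PrimeGraphQuestion G := by
  have := Fintype.ofFinite G
  have hinj := orderOf_injective _ (groupToNormalizedUnits_injective G)
  refine SimpleGraph.Subgraph.ext ?_ ?_
  · ext p
    refine ⟨?_, fun ⟨g, hg⟩ => ⟨groupToNormalizedUnits G g, by rw [hinj, hg]⟩⟩
    rintro ⟨x, hx⟩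
    have : Fact (p : ℕ).Prime := ⟨p.2⟩
    rw [← orderOf_coe_coe_normalizedUnits] at hx
    refine exists_prime_orderOf_dvd_card' p (prime_dvd_card_of_pow_eq_one p.2
      (orderOf_dvd_iff_pow_eq_one.1 hx.dvd) (augmentation_coe_normalizedUnits x) fun h => ?_)
    rw [h, orderOf_one] at hx
    exact p.2.one_lt.ne hx
  · ext p q
    refine ⟨?_, fun ⟨hne, g, hg⟩ => ⟨hne, groupToNormalizedUnits G g, by rw [hinj, hg]⟩⟩
    rintro ⟨hne, x, hx⟩
    exact ⟨hne, h p q p.2 q.2 (fun h => hne (Subtype.ext h)) _ (augmentation_coe_normalizedUnits x)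
      (by rw [orderOf_coe_coe_normalizedUnits, hx])⟩

theorem PrimeGraphQuestion.exists_orderOf_eq {G : Type*} [Group G] (hG : PrimeGraphQuestion G)
    {p q : ℕ} (hp : p.Prime) (hq : q.Prime) (hpq : p ≠ q) {u : MonoidAlgebra ℤ G}
    (haug : augmentation G u = 1) (hu : orderOf u = p * q) : ∃ g : G, orderOf g = p * q := by
  have hpos : 0 < p * q := Nat.mul_pos hp.pos hq.pos
  have hpow : u ^ (p * q) = 1 := hu ▸ pow_orderOf_eq_one u
  let x : (MonoidAlgebra ℤ G)ˣ := Units.ofPowEqOne u _ hpow hpos.ne'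
  have hx : x ∈ normalizedUnits G := by
    rw [normalizedUnits, MonoidHom.mem_ker]
    ext
    exact haug
  have hadj : (primeGraph (normalizedUnits G)).Adj ⟨p, hp⟩ ⟨q, hq⟩ := by
    refine ⟨fun h => hpq (congrArg Subtype.val h), ⟨x, hx⟩, ?_⟩
    rw [← orderOf_coe_coe_normalizedUnits]
    exact hu
  rw [show primeGraph (normalizedUnits G) = primeGraph G from hG] at hadj
  exact hadj.2

/-! ### Almost simplicity and the induction -/

/-- If every nontrivial normal subgroup of a finite group without elements of order `p * q` has order
divisible by the primes `p` and `q`, then the group is almost simple. -/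
theorem isAlmostSimple_of_forall_normal {G : Type u} [Group G] [Finite G] [Nontrivial G] {p q : ℕ}
    (hp : p.Prime) (hq : q.Prime) (hpq : p ≠ q) (hG : ∀ g : G, orderOf g ≠ p * q)
    (hdvd : ∀ N : Subgroup G, N.Normal → N ≠ ⊥ → p ∣ Nat.card N ∧ q ∣ Nat.card N) :
    IsAlmostSimple G := by
  have : Fact p.Prime := ⟨hp⟩
  have : Fact q.Prime := ⟨hq⟩
  have hcomm : ∀ K L : Subgroup G, p ∣ Nat.card K → q ∣ Nat.card L →
      ¬ ∀ x ∈ K, ∀ y ∈ L, Commute x y := by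
    intro K L hK hL h
    obtain ⟨x, hx⟩ := exists_prime_orderOf_dvd_card' p hK
    obtain ⟨y, hy⟩ := exists_prime_orderOf_dvd_card' q hL
    rw [← Subgroup.orderOf_coe] at hx hy
    apply hG (x * y)
    rw [(h x x.2 y y.2).orderOf_mul_eq_mul_orderOf_of_coprime
      (by rw [hx, hy]; exact (Nat.coprime_primes hp hq).2 hpq), hx, hy]
  obtain ⟨N, ⟨hNn, hN⟩, hNmin⟩ := exists_minimal_of_wellFoundedLT
    (fun N : Subgroup G => N.Normal ∧ N ≠ ⊥) ⟨⊤, inferInstance, top_ne_bot⟩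
  obtain ⟨hpN, hqN⟩ := hdvd N hNn hN
  have hcent : Subgroup.centralizer (N : Set G) = ⊥ := by
    by_contra h
    refine hcomm N _ hpN (hdvd _ inferInstance h).2 fun x hx y hy => ?_
    exact Subgroup.mem_centralizer_iff.1 hy x hx
  have hnontriv : Nontrivial N := (Subgroup.nontrivial_iff_ne_bot N).2 hN
  -- subgroups of `N` invariant under conjugation by `G`
  have hinv : ∀ M : Subgroup N, M ≠ ⊥ →
      (∀ g : G, M.map (MulAut.conjNormal g : MulAut N).toMonoidHom ≤ M) → M = ⊤ := by
    intro M hM hMinv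
    have hn : (M.map N.subtype).Normal := by
      refine ⟨?_⟩
      rintro _ ⟨m, hm, rfl⟩ g
      exact ⟨MulAut.conjNormal g m, hMinv g ⟨m, hm, rfl⟩, by simp⟩
    have hne : M.map N.subtype ≠ ⊥ := by
      rwa [Ne, Subgroup.map_eq_bot_iff_of_injective _ N.subtype_injective]
    have h := hNmin ⟨hn, hne⟩ (Subgroup.map_subtype_le M)
    rw [eq_top_iff]
    intro x _
    obtain ⟨m, hm, hmx⟩ := h x.2
    rwa [← N.subtype_injective hmx]
  have hmapn : ∀ (M : Subgroup N), M.Normal → ∀ g : G,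
      (M.map (MulAut.conjNormal g : MulAut N).toMonoidHom).Normal := fun M hM g =>
    hM.map _ (MulAut.conjNormal g : MulAut N).surjective
  have hmapcard : ∀ (M : Subgroup N) (g : G),
      Nat.card (M.map (MulAut.conjNormal g : MulAut N).toMonoidHom) = Nat.card M := fun M g =>
    Subgroup.card_map_of_injective (MulAut.conjNormal g : MulAut N).injective
  -- A maximal nontrivial normal subgroup K of N with order prime to r absorbs each G-conjugate L,
  -- since |LK| divides |L||K|. Minimality of N then gives K = N.
  have hdvdN : ∀ r : ℕ, r.Prime → r ∣ Nat.card N → ∀ M : Subgroup N, M.Normal → M ≠ ⊥ →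
      r ∣ Nat.card M := by
    intro r hr hrN M hMn hM
    by_contra hrM
    obtain ⟨K, ⟨hKn, hK, hrK⟩, hKmax⟩ := exists_maximal_of_wellFoundedGT
      (fun M : Subgroup N => M.Normal ∧ M ≠ ⊥ ∧ ¬ r ∣ Nat.card M) ⟨M, hMn, hM, hrM⟩
    have hK' : K = ⊤ := by
      refine hinv K hK fun g => ?_
      set L := K.map (MulAut.conjNormal g : MulAut N).toMonoidHom with hL
      have hLn : L.Normal := hmapn K hKn g
      have hcard : ¬ r ∣ Nat.card (L ⊔ K : Subgroup N) := by
        rw [← Subgroup.relIndex_bot_left, ← Subgroup.relIndex_mul_relIndex ⊥ K (L ⊔ K) bot_le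
          le_sup_right, Subgroup.relIndex_sup_right, Subgroup.relIndex_bot_left, hr.dvd_mul]
        rintro (h | h)
        · exact hrK h
        · exact hrK (hmapcard K g ▸ h.trans (Subgroup.relIndex_dvd_card K L))
      exact le_sup_left.trans (hKmax ⟨inferInstance,
        fun h => hK (le_bot_iff.1 (h ▸ le_sup_right)), hcard⟩ le_sup_right)
    rw [hK', Subgroup.card_top] at hrK
    exact hrK hrN
  have hsimple : IsSimpleGroup N := by
    obtain ⟨M, ⟨hMn, hM⟩, hMmin⟩ := exists_minimal_of_wellFoundedLT
      (fun M : Subgroup N => M.Normal ∧ M ≠ ⊥) ⟨⊤, inferInstance, top_ne_bot⟩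
    have hMtop : M = ⊤ := by
      refine hinv M hM fun g => ?_
      set L := M.map (MulAut.conjNormal g : MulAut N).toMonoidHom with hL
      have hLn : L.Normal := hmapn M hMn g
      have hLcard : Nat.card L = Nat.card M := hmapcard M g
      -- If M met its conjugate L trivially, M and L would commute, with orders divisible by p and
      -- by q.
      by_cases hML : M ⊓ L = ⊥
      · exfalso
        refine hcomm (M.map N.subtype) (L.map N.subtype) ?_ ?_ ?_
        · rw [Subgroup.card_map_of_injective N.subtype_injective]
          exact hdvdN p hp hpN M hMn hM
        · rw [Subgroup.card_map_of_injective N.subtype_injective, hLcard]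
          exact hdvdN q hq hqN M hMn hM
        · rintro _ ⟨x, hx, rfl⟩ _ ⟨y, hy, rfl⟩
          exact (Subgroup.commute_of_normal_of_disjoint M L hMn hLn (disjoint_iff.2 hML) x y hx
            hy).map N.subtype
      · have h1 : M ≤ L := (hMmin ⟨inferInstance, hML⟩ inf_le_left).trans inf_le_right
        exact (Subgroup.eq_of_le_of_card_ge h1 hLcard.le).ge
    refine ⟨fun K hK => ?_⟩
    by_cases h : K = ⊥
    · exact Or.inl h
    · exact Or.inr (top_le_iff.1 (hMtop ▸ hMmin ⟨hK, h⟩ (hMtop ▸ le_top)))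
  refine ⟨N, inferInstance, inferInstance, hsimple, ?_, (MulAut.conjNormal : G →* MulAut N).range,
    ?_, ⟨MonoidHom.ofInjective ?_⟩⟩
  · by_contra! h
    refine hcomm N N hpN hqN fun x hx y hy => ?_
    exact congrArg Subtype.val (h ⟨x, hx⟩ ⟨y, hy⟩)
  · rintro _ ⟨x, rfl⟩
    exact ⟨x, by ext y; simp⟩
  · rw [injective_iff_map_eq_one]
    intro g hg
    rw [← Subgroup.mem_bot, ← hcent, Subgroup.mem_centralizer_iff]
    intro x hx
    have h1 := congrArg Subtype.val (DFunLike.congr_fun hg ⟨x, hx⟩)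
    rw [MulAut.conjNormal_apply, MulAut.one_apply] at h1
    exact (mul_inv_eq_iff_eq_mul.1 h1).symm

theorem primeGraphQuestion_of_almostSimple_quotients (n : ℕ) : ∀ (G : Type u) [Group G] [Finite G],
    Nat.card G = n → (∀ (X : Type u) [Group X] (f : G →* X), Function.Surjective f →
      IsAlmostSimple X → PrimeGraphQuestion X) → PrimeGraphQuestion G := by
  induction n using Nat.strong_induction_on with | _ n ih => ?_
  intro G _ _ hn h
  have := Fintype.ofFinite G
  refine primeGraphQuestion_of_forall fun p q hp hq hpq u haug hu => ?_
  by_contra! hG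
  -- The primes are quantified afresh so that their roles can be exchanged.
  have key : ∀ p q : ℕ, p.Prime → q.Prime → p ≠ q → orderOf u = p * q →
      (∀ g : G, orderOf g ≠ p * q) → ∀ N : Subgroup G, N.Normal → N ≠ ⊥ → q ∣ Nat.card N := by
    intro p q hp hq hpq hu hG N hNn hN
    by_contra hqN
    have hlt : Nat.card (G ⧸ N) < n := by
      rw [← hn, N.card_eq_card_quotient_mul_card_subgroup]
      exact lt_mul_of_one_lt_right Nat.card_pos ((Subgroup.one_lt_card_iff_ne_bot N).2 hN)
    have hPQ := ih _ hlt (G ⧸ N) rfl fun X _ f hf =>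
      h X (f.comp (QuotientGroup.mk' N)) (hf.comp (QuotientGroup.mk'_surjective N))
    have hupq : u ^ (p * q) = 1 := hu ▸ pow_orderOf_eq_one u
    have hup : u ^ p ≠ 1 :=
      pow_ne_one_of_lt_orderOf hp.ne_zero (hu ▸ lt_mul_of_one_lt_right hp.pos hq.one_lt)
    have huq : u ^ q ≠ 1 :=
      pow_ne_one_of_lt_orderOf hq.ne_zero (hu ▸ lt_mul_of_one_lt_left hq.pos hp.one_lt)
    set v := mapDomainRingHom ℤ (QuotientGroup.mk' N) u with hv
    have hvp : v ^ p ≠ 1 := fun hvp => hqN <| prime_dvd_card_of_map_mk_eq_one hq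
      (u := u ^ p) (by rw [← pow_mul, hupq]) (by rw [map_pow, haug, one_pow]) hup N
      (by rw [map_pow, ← hv, hvp])
    have hvq : v ^ q ≠ 1 := not_map_mk_pow_eq_one hp hq hpq hG hupq haug huq N hqN
      fun hv1 => hvp (by rw [hv, hv1, one_pow])
    obtain ⟨x, hx⟩ := hPQ.exists_orderOf_eq hp hq hpq
      (by rw [hv, augmentation_mapDomainRingHom, haug])
      (orderOf_eq_prime_mul_prime hp hq (by rw [hv, ← map_pow, hupq, map_one]) hvp hvq)
    obtain ⟨g, rfl⟩ := QuotientGroup.mk'_surjective N x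
    obtain ⟨y, hy⟩ := exists_orderOf_eq_of_dvd (hx ▸ orderOf_map_dvd (QuotientGroup.mk' N) g)
    exact hG y hy
  have hdvd : ∀ N : Subgroup G, N.Normal → N ≠ ⊥ → p ∣ Nat.card N ∧ q ∣ Nat.card N :=
    fun N hNn hN => ⟨key q p hq hp hpq.symm (by rw [hu, mul_comm])
      (fun g => by rw [mul_comm]; exact hG g) N hNn hN, key p q hp hq hpq hu hG N hNn hN⟩
  have hnt : Nontrivial G := by
    by_contra hsub
    rw [not_nontrivial_iff_subsingleton] at hsub
    have h1 : u = MonoidAlgebra.single 1 (u.coeff 1) := by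
      ext g
      simp [Subsingleton.elim g 1]
    have h2 := augmentation_eq_sum_coeff u
    rw [haug, Fintype.sum_subsingleton _ 1] at h2
    rw [h1, ← h2, ← MonoidAlgebra.one_def, orderOf_one] at hu
    exact hp.one_lt.ne' (Nat.eq_one_of_mul_eq_one_right hu.symm)
  obtain ⟨g, hg⟩ := (h G (MonoidHom.id G) Function.surjective_id
    (isAlmostSimple_of_forall_normal hp hq hpq hG hdvd)).exists_orderOf_eq hp hq hpq haug hu
  exact hG g hg

theorem mainTheorem1 (G : Type u) [Group G] [Finite G]
    (h : ∀ (X : Type u) [Group X] (f : G →* X), Function.Surjective f → IsAlmostSimple X →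
      PrimeGraphQuestion X) :
    PrimeGraphQuestion G :=
  primeGraphQuestion_of_almostSimple_quotients _ G rfl h
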